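/- Let $d\ge 2$ be an integer and let $0<a<b$ and $0<p<1$ be real numbers. For $n\ge 3$ let $W_n$ be the set of edges of the torus $\mathbb Z_n^d$, i.e. of the graph in which two vertices are adjacent if they differ by $\pm1$ (mod $n$) in exactly one coordinate and agree in all the others. Let $\Omega_n=\{a,b\}^{W_n}$ carry the product probability measure under which the passage times $\omega_e$ of the edges $e\in W_n$ are independent, equal to $a$ with probability $p$ and to $b$ with probability $1-p$. Let $f^\tau=f^\tau_n:\Omega_n\to\mathbb R$ be the first-passage time on the torus, i.e. the minimum of $T(\gamma,\omega)=\sum_{e\in\gamma}\omega_e$ over all closed paths $\gamma$ (without repeated vertices) that wrap around the torus exactly once in the direction of the first coordinate. For $j\in W_n$ and $\varphi:\Omega_n\to\mathbb R$ let $\partial_j\varphi=\varphi\circ\sigma_j^b-\varphi\circ\sigma_j^a$, where $\sigma_j^\delta(\omega)$ is $\omega$ with the passage time of the edge $j$ replaced by $\delta$; for $M=\{i,j\}$ with $i\ne j$ put $\partial_M\varphi=\partial_i\partial_j\varphi$. A pair of distinct edges $\{i,j\}$ is called convoluted on $\omega$ if $\partial_i\partial_jf^\tau(\omega)\neq0$,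 and $N_2(\omega)$ denotes the number of convoluted (unordered) pairs on $\omega$. Then there exist constants $C,\hat C>0$ and an integer $n_0$, depending only on $d,a,b,p$, such that for all $n\ge n_0$ $$\mathrm{var}(f^\tau)\;\le\; C\,\frac{\sum_{M\subseteq W_n,\,|M|=2}\|\partial_Mf^\tau\|_2^2}{(\log n)^2}\;\le\;\hat C\,\frac{\mathbb E[N_2]}{(\log n)^2},$$ where $\|g\|_2=(\mathbb E[|g|^2])^{1/2}$. -/

import Mathlib

open MeasureTheory ProbabilityTheory

noncomputable section

namespace TorusFPP

/-! ### The torus and its edges -/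

/-- The torus `ℤ_n^d`: two distinct vertices are adjacent iff they differ by `±1` (mod `n`) in one
coordinate and agree in all the other coordinates. -/
def torus (d n : ℕ) : SimpleGraph (Fin d → ZMod n) where
  Adj u v := u ≠ v ∧ ∃ k, (u k - v k = 1 ∨ u k - v k = -1) ∧ ∀ l, l ≠ k → u l = v l
  symm := ⟨by
    rintro u v ⟨huv, k, hk, h⟩
    refine ⟨huv.symm, k, ?_, fun l hl => (h l hl).symm⟩
    rcases hk with hk | hk
    · right; rw [← neg_sub, hk]
    · left; rw [← neg_sub, hk, neg_neg]⟩
  loopless := ⟨fun _ h => h.1 rfl⟩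

/-- The set `W_n` of edges of the torus. -/
abbrev Edge (d n : ℕ) : Type := (torus d n).edgeSet

instance instFintypeEdge (d n : ℕ) [NeZero n] : Fintype (Edge d n) := Fintype.ofFinite _

/-! ### Environments -/

/-- The sample space `Ω = {a, b}^W`. -/
abbrev Env (a b : ℝ) (W : Type*) : Type _ := W → ({a, b} : Set ℝ)

/-- The passage time `a`, as an element of `{a, b}`. -/
def timeA (a b : ℝ) : ({a, b} : Set ℝ) := ⟨a, by simp⟩

/-- The passage time `b`, as an element of `{a, b}`. -/
def timeB (a b : ℝ) : ({a, b} : Set ℝ) := ⟨b, by simp⟩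

/-- The law of the passage time of one edge: `a` with probability `p`, `b` with probability
`1 - p`. -/
def edgeLaw (a b p : ℝ) : Measure ({a, b} : Set ℝ) :=
  ENNReal.ofReal p • Measure.dirac (timeA a b) + ENNReal.ofReal (1 - p) • Measure.dirac (timeB a b)

/-- The law of the environment: the passage times of the edges are independent. -/
def envLaw (a b p : ℝ) (W : Type*) [Fintype W] : Measure (Env a b W) :=
  Measure.pi fun _ => edgeLaw a b p

/-! ### Environment derivatives -/

section Derivatives

variable {a b : ℝ} {W : Type*} [DecidableEq W]

/-- `σ_j^δ(ω)`: the environment `ω` with the passage time of the edge `j` changed to `δ`. -/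
def setEdge (j : W) (δ : ({a, b} : Set ℝ)) (ω : Env a b W) : Env a b W :=
  Function.update ω j δ

/-- The first order environment derivative `∂_j φ = φ ∘ σ_j^b - φ ∘ σ_j^a`. -/
def envDeriv (j : W) (φ : Env a b W → ℝ) : Env a b W → ℝ :=
  fun ω => φ (setEdge j (timeB a b) ω) - φ (setEdge j (timeA a b) ω)

theorem envDeriv_comm (i j : W) (φ : Env a b W → ℝ) :
    envDeriv i (envDeriv j φ) = envDeriv j (envDeriv i φ) := by
  by_cases h : i = j
  · rw [h]
  · funext ω
    simp only [envDeriv, setEdge, Function.update_comm h]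
    ring

instance instLeftCommutativeEnvDeriv :
    LeftCommutative (envDeriv : W → (Env a b W → ℝ) → (Env a b W → ℝ)) :=
  ⟨envDeriv_comm⟩

/-- The environment derivative `∂_S φ`, obtained by applying `∂_j` once for each `j ∈ S`, in an
arbitrary order. -/
def setDeriv (S : Finset W) (φ : Env a b W → ℝ) : Env a b W → ℝ :=
  S.val.foldr envDeriv φ

theorem setDeriv_pair {i j : W} (h : i ≠ j) (φ : Env a b W → ℝ) :
    setDeriv {i, j} φ = envDeriv i (envDeriv j φ) := by
  rw [setDeriv, Finset.insert_val_of_notMem (by simpa using h), Multiset.foldr_cons]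
  simp

/-- The number `N_2(ω)` of convoluted pairs on `ω`, i.e. of two-element sets `{i, j}` of edges with
`∂_i ∂_j φ (ω) ≠ 0`. -/
def numConvoluted [Fintype W] (φ : Env a b W → ℝ) (ω : Env a b W) : ℕ :=
  Set.ncard {M : Finset W | ∃ i j, i ≠ j ∧ M = {i, j} ∧ envDeriv i (envDeriv j φ) ω ≠ 0}

end Derivatives

/-- The `L²`-norm of a random variable. -/
def l2Norm {Ω : Type*} [MeasurableSpace Ω] (μ : Measure Ω) (g : Ω → ℝ) : ℝ :=
  (eLpNorm g 2 μ).toReal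

/-! ### The first-passage time on the torus -/

/-- The displacement in the first coordinate of a lift to `ℤ^d` of a walk on the torus: a step
from `x` to `y` contributes the representative of `y 0 - x 0` of least absolute value, which for
`n ≥ 3` is `1`, `-1` or `0`. -/
def liftedDisplacement {d n : ℕ} [NeZero d] {u v : Fin d → ZMod n} (c : (torus d n).Walk u v) : ℤ :=
  (c.darts.map fun e => (e.snd 0 - e.fst 0).valMinAbs).sum

/-- `γ` is the set of edges of a closed path without repeated vertices that wraps around the torus
exactly once in the direction of the first coordinate. Such a loop has a step from `x 0 = n - 1` to
`x 0 = 0`; cutting it there presents it as a path from some `s` with `s 0 = 0` to the vertex `e` with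
`e 0 = n - 1` that agrees with `s` in the other coordinates, closed up by the edge from `e` to `s`. -/
def IsAdmissible {d n : ℕ} [NeZero d] (γ : Finset (Edge d n)) : Prop :=
  ∃ (v : Fin d → ZMod n) (c : (torus d n).Walk v v),
    c.IsCycle ∧ liftedDisplacement c = n ∧ ∀ e : Edge d n, e ∈ γ ↔ (e : Sym2 _) ∈ c.edges

/-- The passage time `T(γ, ω)`. -/
def passageTime {a b : ℝ} {W : Type*} (γ : Finset W) (ω : Env a b W) : ℝ :=
  ∑ e ∈ γ, (ω e : ℝ)

/-- The first-passage time `f^τ_n` on the torus: the minimum of the passage times of the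
admissible paths (for `n ≥ 3`, the infimum is over a finite non-empty set). -/
def fpt (a b : ℝ) (d n : ℕ) [NeZero d] (ω : Env a b (Edge d n)) : ℝ :=
  sInf {t : ℝ | ∃ γ : Finset (Edge d n), IsAdmissible γ ∧ t = passageTime γ ω}

end TorusFPP

end

/-!
The first inequality needs no lower bound on the variance. It follows from applying twice a
Talagrand-type inequality (`TorusFPP.variance_mul_log_le`): if every derivative `∂_j φ` vanishes
outside an event of probability at most `δ`, then
`var φ * log (1 / δ) ≤ 2 * ∑ j, E[(∂_j φ)²]`.

For `φ = f^τ` the derivatives do have small supports. If `∂_j f^τ ≠ 0` and the edge `j` has passage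
time `a`, then `j` lies on every geodesic, and a geodesic has at most `n b / a` edges; since the law
and `f^τ` are invariant under the `n ^ d` translations of the torus, the event `∂_j f^τ ≠ 0` has
probability `O(n ^ (1 - d))` (`TorusFPP.prob_envDeriv_fpt_ne_zero_le`), and so has
`∂_i ∂_j f^τ ≠ 0`. For `d ≥ 2` and large `n` both are below `δ = 1 / √n`. The inequality for `f^τ`
bounds `var f^τ` by `∑ j, E[(∂_j f^τ)²] / log n`. A function with a small support has a second
moment comparable to its variance, so `E[(∂_j f^τ)²] ≤ 2 var (∂_j f^τ)`, and the inequality for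
`∂_j f^τ` yields a second factor `log n` (`TorusFPP.variance_mul_log_sq_le`). The second inequality
holds because `|∂_i ∂_j f^τ| ≤ b - a`.

The Talagrand-type inequality is proved by the method of Falik and Samorodnitsky. Averaging out the
edges one after the other decomposes `φ - E φ` into orthogonal martingale differences, which are,
up to factors, averages of the derivatives `∂_j φ`, so their `L¹`-norms are small compared with the
`L²`-norms of the `∂_j φ`. The logarithmic Sobolev inequality for the product measure
(`TorusFPP.log_sobolev`) bounds the entropies of the squares of these differences; the entropies are
at least `log (1 / δ)` times the second moments, up to an error `E[(∂_j φ)²]`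
(`TorusFPP.log_mul_integral_sq_le_entropy`), and the total energy of the differences is at most
`∑ j, E[(∂_j φ)²]` up to a constant (`TorusFPP.sumDiff_energy_le`).
-/

namespace TorusFPP

/-! ### Averaging over one edge -/

section Averaging

variable {a b p : ℝ} {W : Type*}

theorem timeA_ne_timeB (hab : a < b) : timeA a b ≠ timeB a b := fun h =>
  hab.ne (congrArg Subtype.val h)

theorem eq_timeA_or_eq_timeB (x : ({a, b} : Set ℝ)) : x = timeA a b ∨ x = timeB a b := by
  obtain ⟨x, rfl | rfl⟩ := x
  · exact Or.inl rfl
  · exact Or.inr rfl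

theorem isProbabilityMeasure_edgeLaw (hp0 : 0 < p) (hp1 : p < 1) :
    IsProbabilityMeasure (edgeLaw a b p) := by
  constructor
  simp only [edgeLaw, Measure.coe_add, Measure.coe_smul, Pi.add_apply, Pi.smul_apply,
    measure_univ, smul_eq_mul, mul_one]
  rw [← ENNReal.ofReal_add hp0.le (by linarith)]
  simp

theorem isProbabilityMeasure_envLaw [Fintype W] (hp0 : 0 < p) (hp1 : p < 1) :
    IsProbabilityMeasure (envLaw a b p W) := by
  have := isProbabilityMeasure_edgeLaw (a := a) (b := b) hp0 hp1
  unfold envLaw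
  infer_instance

theorem integrable_envLaw [Fintype W] (hp0 : 0 < p) (hp1 : p < 1) (φ : Env a b W → ℝ) :
    Integrable φ (envLaw a b p W) := by
  have := isProbabilityMeasure_envLaw (a := a) (b := b) (W := W) hp0 hp1
  exact Integrable.of_finite

theorem variance_eq_integral_sq_sub [Fintype W] (hp0 : 0 < p) (hp1 : p < 1) (φ : Env a b W → ℝ) :
    variance φ (envLaw a b p W) =
      ∫ ω, φ ω ^ 2 ∂(envLaw a b p W) - (∫ ω, φ ω ∂(envLaw a b p W)) ^ 2 := by
  have := isProbabilityMeasure_envLaw (a := a) (b := b) (W := W) hp0 hp1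
  rw [variance_eq_sub MemLp.of_discrete]
  rfl

theorem edgeLaw_real_timeA (hab : a < b) (hp0 : 0 < p) :
    (edgeLaw a b p).real {timeA a b} = p := by
  simp [edgeLaw, Measure.real, (timeA_ne_timeB hab).symm, hp0.le]

theorem edgeLaw_real_timeB (hab : a < b) (hp1 : p < 1) :
    (edgeLaw a b p).real {timeB a b} = 1 - p := by
  simp [edgeLaw, Measure.real, timeA_ne_timeB hab, hp1.le]

variable [DecidableEq W]

/-- The average of `φ` over the passage time of the edge `j`, all the others being kept. -/
noncomputable def avg (p : ℝ) (j : W) (φ : Env a b W → ℝ) : Env a b W → ℝ :=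
  fun ω => p * φ (setEdge j (timeA a b) ω) + (1 - p) * φ (setEdge j (timeB a b) ω)

theorem integral_avg [Fintype W] (hab : a < b) (hp0 : 0 < p) (hp1 : p < 1) (j : W)
    (φ : Env a b W → ℝ) :
    ∫ ω, avg p j φ ω ∂(envLaw a b p W) = ∫ ω, φ ω ∂(envLaw a b p W) := by
  classical
  have hprob := isProbabilityMeasure_edgeLaw (a := a) (b := b) hp0 hp1
  let : Fintype ({a, b} : Set ℝ) := Fintype.ofFinite _
  have hsum (g : ({a, b} : Set ℝ) → ℝ) : ∑ x, g x = g (timeA a b) + g (timeB a b) :=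
    Fintype.sum_eq_add _ _ (timeA_ne_timeB hab) fun x hx =>
      ((eq_timeA_or_eq_timeB x).elim hx.1 hx.2).elim
  have hweight (ω : Env a b W) : (envLaw a b p W).real {ω} =
      (edgeLaw a b p).real {ω j} * ∏ i : {i // i ≠ j}, (edgeLaw a b p).real {ω i} := by
    rw [envLaw, Measure.real, Measure.pi_singleton, ENNReal.toReal_prod,
      Fintype.prod_eq_mul_prod_subtype_ne _ j]
    rfl
  rw [integral_fintype (integrable_envLaw hp0 hp1 _), integral_fintype (integrable_envLaw hp0 hp1 _),
    ← (Equiv.funSplitAt j ({a, b} : Set ℝ)).symm.sum_comp,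
    ← (Equiv.funSplitAt j ({a, b} : Set ℝ)).symm.sum_comp,
    Fintype.sum_prod_type_right, Fintype.sum_prod_type_right]
  refine Finset.sum_congr rfl fun y _ => ?_
  have hset (x δ : ({a, b} : Set ℝ)) :
      setEdge j δ ((Equiv.funSplitAt j ({a, b} : Set ℝ)).symm (x, y)) =
        (Equiv.funSplitAt j ({a, b} : Set ℝ)).symm (δ, y) := by
    funext i
    by_cases h : i = j
    · subst h; simp [setEdge]
    · simp [setEdge, h]
  have hself (x : ({a, b} : Set ℝ)) :
      (Equiv.funSplitAt j ({a, b} : Set ℝ)).symm (x, y) j = x := by simp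
  have hrest (x : ({a, b} : Set ℝ)) (i : {i // i ≠ j}) :
      (Equiv.funSplitAt j ({a, b} : Set ℝ)).symm (x, y) i = y i := by
    simp [i.2]
  simp only [hweight, hsum, avg, hset, hself, hrest, smul_eq_mul, edgeLaw_real_timeA hab hp0,
    edgeLaw_real_timeB hab hp1]
  ring

theorem setEdge_setEdge_same (j : W) (δ ε : ({a, b} : Set ℝ)) (ω : Env a b W) :
    setEdge j δ (setEdge j ε ω) = setEdge j δ ω := by
  simp [setEdge]

theorem envDeriv_setEdge_same (j : W) (δ : ({a, b} : Set ℝ)) (φ : Env a b W → ℝ)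
    (ω : Env a b W) : envDeriv j φ (setEdge j δ ω) = envDeriv j φ ω := by
  simp [envDeriv, setEdge_setEdge_same]

theorem envDeriv_envDeriv_same (j : W) (φ : Env a b W → ℝ) :
    envDeriv j (envDeriv j φ) = 0 := by
  funext ω
  simp [envDeriv, setEdge_setEdge_same]

theorem avg_setEdge_same (j : W) (δ : ({a, b} : Set ℝ)) (φ : Env a b W → ℝ)
    (ω : Env a b W) : avg p j φ (setEdge j δ ω) = avg p j φ ω := by
  simp [avg, setEdge_setEdge_same]

theorem envDeriv_avg_same (j : W) (φ : Env a b W → ℝ) : envDeriv j (avg p j φ) = 0 := by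
  funext ω
  rw [envDeriv, avg_setEdge_same, avg_setEdge_same]
  simp

theorem envDeriv_avg_of_ne {i j : W} (h : i ≠ j) (φ : Env a b W → ℝ) :
    envDeriv i (avg p j φ) = avg p j (envDeriv i φ) := by
  funext ω
  simp only [envDeriv, avg, setEdge, Function.update_comm h]
  ring

/-- The pointwise variance identity on the two-point space `{a, b}`. -/
theorem avg_sq (j : W) (φ : Env a b W → ℝ) (ω : Env a b W) :
    avg p j (fun ω => φ ω ^ 2) ω = avg p j φ ω ^ 2 + p * (1 - p) * envDeriv j φ ω ^ 2 := by
  simp only [avg, envDeriv]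
  ring

theorem avg_mono (hp0 : 0 < p) (hp1 : p < 1) (j : W) {φ ψ : Env a b W → ℝ} (h : ∀ ω, φ ω ≤ ψ ω)
    (ω : Env a b W) : avg p j φ ω ≤ avg p j ψ ω := by
  have : 0 ≤ 1 - p := by linarith
  unfold avg
  gcongr <;> exact h _

theorem abs_avg_le (hp0 : 0 < p) (hp1 : p < 1) (j : W) (φ : Env a b W → ℝ) (ω : Env a b W) :
    |avg p j φ ω| ≤ avg p j (fun ω => |φ ω|) ω :=
  abs_le.2 ⟨by
    have := avg_mono hp0 hp1 j (fun ω => neg_abs_le (φ ω)) ω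
    simp only [avg] at this ⊢
    linarith, avg_mono hp0 hp1 j (fun ω => le_abs_self (φ ω)) ω⟩

/-- A function that depends on no edge is constant. -/
theorem eq_of_forall_setEdge [Fintype W] {φ : Env a b W → ℝ}
    (h : ∀ j δ ω, φ (setEdge j δ ω) = φ ω) (ω η : Env a b W) : φ ω = φ η := by
  have key (s : Finset W) : φ (s.piecewise ω η) = φ η := by
    induction s using Finset.induction_on with
    | empty => simp
    | insert j s _ ih => rw [Finset.piecewise_insert, ← ih]; exact h j (ω j) _
  simpa using key Finset.univ

end Averaging

/-! ### The martingale decomposition of the variance -/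

section Martingale

variable {a b p : ℝ} {W : Type*} [DecidableEq W]

/-- The average of `φ` over the passage times of all the edges in the list `l`. -/
noncomputable def listAvg (p : ℝ) (l : List W) (φ : Env a b W → ℝ) : Env a b W → ℝ :=
  l.foldl (fun ψ j => avg p j ψ) φ

@[simp] theorem listAvg_nil (φ : Env a b W → ℝ) : listAvg p [] φ = φ := rfl

@[simp] theorem listAvg_cons (j : W) (l : List W) (φ : Env a b W → ℝ) :
    listAvg p (j :: l) φ = listAvg p l (avg p j φ) := rfl

/-- The sum `∑_k F (∂_{j_k} A_{j_{k-1}} ⋯ A_{j_1} φ)` over the list `l = [j_1, …, j_m]`, where `A_j`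
is the average over the edge `j`. The martingale difference obtained by averaging out the `k`-th
edge is `∂_{j_k} A_{j_{k-1}} ⋯ A_{j_1} φ` times a centred function of the passage time of `j_k`,
whose variance is `p (1 - p)`. -/
noncomputable def sumDiff (p : ℝ) (F : (Env a b W → ℝ) → ℝ) : List W → (Env a b W → ℝ) → ℝ
  | [], _ => 0
  | j :: l, φ => F (envDeriv j φ) + sumDiff p F l (avg p j φ)

theorem sumDiff_le_sumDiff {F G : (Env a b W → ℝ) → ℝ} (h : ∀ φ, F φ ≤ G φ) (l : List W)
    (φ : Env a b W → ℝ) : sumDiff p F l φ ≤ sumDiff p G l φ := by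
  induction l generalizing φ with
  | nil => exact le_rfl
  | cons j l ih => exact add_le_add (h _) (ih _)

theorem listAvg_setEdge (l : List W) {j : W} (hj : j ∈ l) (δ : ({a, b} : Set ℝ))
    (φ : Env a b W → ℝ) (ω : Env a b W) :
    listAvg p l φ (setEdge j δ ω) = listAvg p l φ ω := by
  have inv (l : List W) (ψ : Env a b W → ℝ) (hψ : ∀ ω, ψ (setEdge j δ ω) = ψ ω) :
      ∀ ω, listAvg p l ψ (setEdge j δ ω) = listAvg p l ψ ω := by
    induction l generalizing ψ with
    | nil => exact hψ
    | cons i l ih =>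
      refine ih _ fun ω => ?_
      by_cases h : i = j
      · subst h; exact avg_setEdge_same _ _ _ _
      · have hc (ε : ({a, b} : Set ℝ)) :
            setEdge i ε (setEdge j δ ω) = setEdge j δ (setEdge i ε ω) :=
          (Function.update_comm h _ _ _).symm
        simp only [avg, hc, hψ]
  induction l generalizing φ with
  | nil => simp at hj
  | cons i l ih =>
    rcases List.mem_cons.1 hj with rfl | hj
    · exact inv l _ (fun ω => avg_setEdge_same _ _ _ _) ω
    · exact ih hj _

variable [Fintype W]

theorem integral_listAvg (hab : a < b) (hp0 : 0 < p) (hp1 : p < 1) (l : List W)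
    (φ : Env a b W → ℝ) :
    ∫ ω, listAvg p l φ ω ∂(envLaw a b p W) = ∫ ω, φ ω ∂(envLaw a b p W) := by
  induction l generalizing φ with
  | nil => rfl
  | cons j l ih => rw [listAvg_cons, ih, integral_avg hab hp0 hp1]

/-- Averaging over all the edges yields the expectation. -/
theorem listAvg_univ (hab : a < b) (hp0 : 0 < p) (hp1 : p < 1) (φ : Env a b W → ℝ)
    (ω : Env a b W) :
    listAvg p (Finset.univ : Finset W).toList φ ω = ∫ ω, φ ω ∂(envLaw a b p W) := by
  have := isProbabilityMeasure_envLaw (a := a) (b := b) (W := W) hp0 hp1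
  rw [← integral_listAvg hab hp0 hp1 (Finset.univ : Finset W).toList φ]
  have hconst (η : Env a b W) : listAvg p (Finset.univ : Finset W).toList φ η =
      listAvg p (Finset.univ : Finset W).toList φ ω :=
    eq_of_forall_setEdge (fun j δ ω => listAvg_setEdge _ (by simp) δ φ ω) η ω
  simp [hconst]

theorem integral_sq_eq_avg (hab : a < b) (hp0 : 0 < p) (hp1 : p < 1) (j : W)
    (φ : Env a b W → ℝ) :
    ∫ ω, φ ω ^ 2 ∂(envLaw a b p W) = ∫ ω, avg p j φ ω ^ 2 ∂(envLaw a b p W) +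
      p * (1 - p) * ∫ ω, envDeriv j φ ω ^ 2 ∂(envLaw a b p W) := by
  rw [← integral_avg hab hp0 hp1 j (fun ω => φ ω ^ 2), ← integral_const_mul,
    ← integral_add (integrable_envLaw hp0 hp1 _) (integrable_envLaw hp0 hp1 _)]
  simp only [avg_sq]

theorem integral_avg_sq_le (hab : a < b) (hp0 : 0 < p) (hp1 : p < 1) (j : W)
    (φ : Env a b W → ℝ) :
    ∫ ω, avg p j φ ω ^ 2 ∂(envLaw a b p W) ≤ ∫ ω, φ ω ^ 2 ∂(envLaw a b p W) := by
  rw [integral_sq_eq_avg hab hp0 hp1 j φ]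
  have : 0 ≤ 1 - p := by linarith
  have : 0 ≤ ∫ ω, envDeriv j φ ω ^ 2 ∂(envLaw a b p W) := integral_nonneg fun ω => sq_nonneg _
  simp only [le_add_iff_nonneg_right]
  positivity

theorem integral_abs_avg_le (hab : a < b) (hp0 : 0 < p) (hp1 : p < 1) (j : W)
    (φ : Env a b W → ℝ) :
    ∫ ω, |avg p j φ ω| ∂(envLaw a b p W) ≤ ∫ ω, |φ ω| ∂(envLaw a b p W) := by
  rw [← integral_avg hab hp0 hp1 j (fun ω => |φ ω|)]
  exact integral_mono (integrable_envLaw hp0 hp1 _) (integrable_envLaw hp0 hp1 _)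
    fun ω => abs_avg_le hp0 hp1 j φ ω

/-- Orthogonality of the martingale differences. -/
theorem integral_sq_eq_listAvg (hab : a < b) (hp0 : 0 < p) (hp1 : p < 1) (l : List W)
    (φ : Env a b W → ℝ) :
    ∫ ω, φ ω ^ 2 ∂(envLaw a b p W) = ∫ ω, listAvg p l φ ω ^ 2 ∂(envLaw a b p W) +
      p * (1 - p) * sumDiff p (fun ψ => ∫ ω, ψ ω ^ 2 ∂(envLaw a b p W)) l φ := by
  induction l generalizing φ with
  | nil => simp [sumDiff]
  | cons j l ih =>
    rw [integral_sq_eq_avg hab hp0 hp1 j φ, ih (avg p j φ), listAvg_cons, sumDiff]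
    ring

theorem variance_eq_sumDiff (hab : a < b) (hp0 : 0 < p) (hp1 : p < 1) (φ : Env a b W → ℝ) :
    variance φ (envLaw a b p W) = p * (1 - p) *
      sumDiff p (fun ψ => ∫ ω, ψ ω ^ 2 ∂(envLaw a b p W)) (Finset.univ : Finset W).toList φ := by
  have := isProbabilityMeasure_envLaw (a := a) (b := b) (W := W) hp0 hp1
  rw [variance_eq_integral_sq_sub hp0 hp1,
    integral_sq_eq_listAvg hab hp0 hp1 (Finset.univ : Finset W).toList φ]
  simp [listAvg_univ hab hp0 hp1]

/-- Summing first over the differences and then over the derivatives: for every `i`, the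
differences of `∂_i φ` are orthogonal. -/
theorem sumDiff_energy_le (hab : a < b) (hp0 : 0 < p) (hp1 : p < 1) (l : List W)
    (φ : Env a b W → ℝ) :
    p * (1 - p) * sumDiff p (fun ψ => ∑ i, ∫ ω, envDeriv i ψ ω ^ 2 ∂(envLaw a b p W)) l φ ≤
      ∑ i, ∫ ω, envDeriv i φ ω ^ 2 ∂(envLaw a b p W) := by
  induction l generalizing φ with
  | nil =>
    rw [sumDiff, mul_zero]
    exact Finset.sum_nonneg fun i _ => integral_nonneg fun ω => sq_nonneg _
  | cons j l ih =>
    rw [sumDiff, mul_add, Finset.mul_sum]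
    refine (add_le_add_right (ih (avg p j φ)) _).trans ?_
    rw [← Finset.sum_add_distrib]
    refine Finset.sum_le_sum fun i _ => ?_
    rw [integral_sq_eq_avg hab hp0 hp1 j (envDeriv i φ), envDeriv_comm i j, add_comm]
    refine add_le_add_left ?_ _
    by_cases h : i = j
    · subst h
      simp only [envDeriv_avg_same, Pi.zero_apply, ne_eq, OfNat.ofNat_ne_zero, not_false_eq_true,
        zero_pow, integral_zero]
      exact integral_nonneg fun ω => sq_nonneg _
    · rw [envDeriv_avg_of_ne h]

end Martingale

/-! ### The logarithmic Sobolev inequality -/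

section LogSobolev

variable {a b p : ℝ} {W : Type*} [DecidableEq W]

/-- The logarithmic Sobolev inequality on a two-point space, from `log x ≤ x - 1` and the
Cauchy–Schwarz inequality. -/
theorem two_point_log_sobolev (hp0 : 0 < p) (hp1 : p < 1) (u v : ℝ) :
    p * (u ^ 2 * Real.log (u ^ 2)) + (1 - p) * (v ^ 2 * Real.log (v ^ 2)) -
      (p * u ^ 2 + (1 - p) * v ^ 2) * Real.log (p * u ^ 2 + (1 - p) * v ^ 2) ≤ (v - u) ^ 2 := by
  have hq : 0 < 1 - p := by linarith
  set m := p * u ^ 2 + (1 - p) * v ^ 2 with hm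
  rcases (show 0 ≤ m by positivity).eq_or_lt with h0 | hpos
  · have hu : u = 0 := by
      by_contra hu
      have : 0 < m := by positivity
      exact h0.not_lt this
    have hv : v = 0 := by
      by_contra hv
      have : 0 < m := by positivity
      exact h0.not_lt this
    simp [← h0, hu, hv]
  have hlog (x : ℝ) : x ^ 2 * Real.log (x ^ 2) ≤ x ^ 2 * Real.log m + x ^ 2 * (x ^ 2 / m - 1) := by
    by_cases hx : x = 0
    · simp [hx]
    have h := Real.log_le_sub_one_of_pos (show 0 < x ^ 2 / m by positivity)
    rw [Real.log_div (by positivity) hpos.ne'] at h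
    nlinarith [mul_le_mul_of_nonneg_left h (sq_nonneg x)]
  have h1 : p * (u ^ 2 * Real.log (u ^ 2)) + (1 - p) * (v ^ 2 * Real.log (v ^ 2)) -
      m * Real.log m ≤ p * (1 - p) * (u + v) ^ 2 * (v - u) ^ 2 / m := by
    have e : p * (1 - p) * (u + v) ^ 2 * (v - u) ^ 2 / m =
        p * (u ^ 2 * (u ^ 2 / m - 1)) + (1 - p) * (v ^ 2 * (v ^ 2 / m - 1)) := by
      field_simp
      rw [hm]
      ring
    rw [e]
    have hl : m * Real.log m = p * (u ^ 2 * Real.log m) + (1 - p) * (v ^ 2 * Real.log m) := by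
      rw [hm]; ring
    rw [hl]
    nlinarith [mul_le_mul_of_nonneg_left (hlog u) hp0.le, mul_le_mul_of_nonneg_left (hlog v) hq.le]
  refine h1.trans ?_
  rw [div_le_iff₀ hpos, mul_comm]
  refine mul_le_mul_of_nonneg_left ?_ (sq_nonneg _)
  -- the difference of the two sides is `(p u - (1 - p) v) ^ 2`
  rw [hm]
  nlinarith [sq_nonneg (p * u - (1 - p) * v)]

/-- The reverse triangle inequality in `L²` of a two-point space. -/
theorem sq_sqrt_sub_sqrt_le (hp0 : 0 < p) (hp1 : p < 1) (u v x y : ℝ) :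
    (√(p * u ^ 2 + (1 - p) * v ^ 2) - √(p * x ^ 2 + (1 - p) * y ^ 2)) ^ 2 ≤
      p * (u - x) ^ 2 + (1 - p) * (v - y) ^ 2 := by
  have hq : 0 < 1 - p := by linarith
  have hA : 0 ≤ p * u ^ 2 + (1 - p) * v ^ 2 := by positivity
  have hB : 0 ≤ p * x ^ 2 + (1 - p) * y ^ 2 := by positivity
  have h : p * (u * x) + (1 - p) * (v * y) ≤
      √(p * u ^ 2 + (1 - p) * v ^ 2) * √(p * x ^ 2 + (1 - p) * y ^ 2) := by
    rw [← Real.sqrt_mul hA]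
    refine Real.le_sqrt_of_sq_le ?_
    nlinarith [mul_nonneg (mul_nonneg hp0.le hq.le) (sq_nonneg (u * y - v * x))]
  nlinarith [Real.sq_sqrt hA, Real.sq_sqrt hB]

variable [Fintype W]

/-- Tensorization: `g` is replaced by the root `h` of the average of `g ^ 2` over one edge after the
other. The derivatives of `h` are controlled by those of `g`. -/
theorem log_sobolev_listAvg (hab : a < b) (hp0 : 0 < p) (hp1 : p < 1) (l : List W)
    (g : Env a b W → ℝ) :
    ∫ ω, g ω ^ 2 * Real.log (g ω ^ 2) ∂(envLaw a b p W) -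
      ∫ ω, listAvg p l (fun ω => g ω ^ 2) ω * Real.log (listAvg p l (fun ω => g ω ^ 2) ω)
        ∂(envLaw a b p W) ≤
      (l.map fun j => ∫ ω, envDeriv j g ω ^ 2 ∂(envLaw a b p W)).sum := by
  have hint := integrable_envLaw (a := a) (b := b) (W := W) hp0 hp1
  have hq : 0 < 1 - p := by linarith
  induction l generalizing g with
  | nil => simp
  | cons j l ih =>
    set h : Env a b W → ℝ := fun ω => √(avg p j (fun ω => g ω ^ 2) ω) with hdef
    have hsq : (fun ω => h ω ^ 2) = avg p j (fun ω => g ω ^ 2) := by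
      funext ω
      refine Real.sq_sqrt ?_
      unfold avg
      positivity
    have h1 : ∫ ω, g ω ^ 2 * Real.log (g ω ^ 2) ∂(envLaw a b p W) -
        ∫ ω, h ω ^ 2 * Real.log (h ω ^ 2) ∂(envLaw a b p W) ≤
        ∫ ω, envDeriv j g ω ^ 2 ∂(envLaw a b p W) := by
      rw [← integral_avg hab hp0 hp1 j (fun ω => g ω ^ 2 * Real.log (g ω ^ 2)),
        ← integral_sub (hint _) (hint _)]
      refine integral_mono (hint _) (hint _) fun ω => ?_
      have e : h ω ^ 2 = avg p j (fun ω => g ω ^ 2) ω := congrFun hsq ω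
      simp only [e]
      exact two_point_log_sobolev hp0 hp1 _ _
    have h2 (i : W) : ∫ ω, envDeriv i h ω ^ 2 ∂(envLaw a b p W) ≤
        ∫ ω, envDeriv i g ω ^ 2 ∂(envLaw a b p W) := by
      rw [← integral_avg hab hp0 hp1 j (fun ω => envDeriv i g ω ^ 2)]
      refine integral_mono (hint _) (hint _) fun ω => ?_
      by_cases hij : i = j
      · subst hij
        have e : envDeriv i h ω = 0 := by
          simp only [envDeriv, hdef, avg_setEdge_same, sub_self]
        simp only [e, avg, ne_eq, OfNat.ofNat_ne_zero, not_false_eq_true, zero_pow]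
        exact add_nonneg (mul_nonneg hp0.le (sq_nonneg _)) (mul_nonneg hq.le (sq_nonneg _))
      · have hc (δ ε : ({a, b} : Set ℝ)) :
            setEdge j δ (setEdge i ε ω) = setEdge i ε (setEdge j δ ω) :=
          Function.update_comm hij _ _ _
        simp only [envDeriv, hdef, avg, hc]
        exact sq_sqrt_sub_sqrt_le hp0 hp1 _ _ _ _
    have h3 := ih h
    rw [hsq] at h3
    rw [List.map_cons, List.sum_cons, listAvg_cons]
    have h4 : (l.map fun i => ∫ ω, envDeriv i h ω ^ 2 ∂(envLaw a b p W)).sum ≤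
        (l.map fun i => ∫ ω, envDeriv i g ω ^ 2 ∂(envLaw a b p W)).sum :=
      List.sum_le_sum fun i _ => h2 i
    linarith

/-- The logarithmic Sobolev inequality on `{a, b}^W`. -/
theorem log_sobolev (hab : a < b) (hp0 : 0 < p) (hp1 : p < 1) (g : Env a b W → ℝ) :
    ∫ ω, g ω ^ 2 * Real.log (g ω ^ 2) ∂(envLaw a b p W) -
      (∫ ω, g ω ^ 2 ∂(envLaw a b p W)) * Real.log (∫ ω, g ω ^ 2 ∂(envLaw a b p W)) ≤
      ∑ j, ∫ ω, envDeriv j g ω ^ 2 ∂(envLaw a b p W) := by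
  have := isProbabilityMeasure_envLaw (a := a) (b := b) (W := W) hp0 hp1
  have h := log_sobolev_listAvg hab hp0 hp1 (Finset.univ : Finset W).toList g
  simpa [listAvg_univ hab hp0 hp1] using h

end LogSobolev

/-! ### Talagrand's inequality for functions of small influences -/

section Talagrand

variable {a b p : ℝ} {W : Type*} [Fintype W]

/-- A function whose `L¹`-norm is much smaller than its `L²`-norm has a large entropy. -/
theorem log_mul_integral_sq_le_entropy (hp0 : 0 < p) (hp1 : p < 1) {δ y : ℝ} (hδ : 0 < δ)
    (g : Env a b W → ℝ) (h1 : (∫ ω, |g ω| ∂(envLaw a b p W)) ^ 2 ≤ δ * y)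
    (h2 : ∫ ω, g ω ^ 2 ∂(envLaw a b p W) ≤ y) :
    Real.log (1 / δ) * ∫ ω, g ω ^ 2 ∂(envLaw a b p W) ≤
      ∫ ω, g ω ^ 2 * Real.log (g ω ^ 2) ∂(envLaw a b p W) -
      (∫ ω, g ω ^ 2 ∂(envLaw a b p W)) * Real.log (∫ ω, g ω ^ 2 ∂(envLaw a b p W)) + y := by
  have hint := integrable_envLaw (a := a) (b := b) (W := W) hp0 hp1
  set x := ∫ ω, g ω ^ 2 ∂(envLaw a b p W) with hx
  set m := ∫ ω, |g ω| ∂(envLaw a b p W) with hm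
  have hm0 : 0 ≤ m := integral_nonneg fun ω => abs_nonneg _
  have hx0 : 0 ≤ x := integral_nonneg fun ω => sq_nonneg _
  rcases hx0.eq_or_lt with hx0 | hxpos
  · have hae := (integral_eq_zero_iff_of_nonneg (μ := envLaw a b p W)
      (fun ω => sq_nonneg (g ω)) (hint _)).1 hx0.symm
    have hz : ∫ ω, g ω ^ 2 * Real.log (g ω ^ 2) ∂(envLaw a b p W) = 0 := by
      refine integral_eq_zero_of_ae (hae.mono fun ω hω => ?_)
      have hω : g ω ^ 2 = 0 := hω
      simp [hω]
    rw [hz, ← hx0]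
    simpa using hx0.le.trans h2
  have hmpos : 0 < m := by
    refine hm0.lt_of_ne fun h => hxpos.ne' ?_
    have hae := (integral_eq_zero_iff_of_nonneg (μ := envLaw a b p W)
      (fun ω => abs_nonneg (g ω)) (hint _)).1 h.symm
    refine integral_eq_zero_of_ae (hae.mono fun ω hω => ?_)
    have hω : |g ω| = 0 := hω
    simp [abs_eq_zero.1 hω]
  have hypos : 0 < y := hxpos.trans_le h2
  -- `log (1 / |g|)` lies below its tangent in the variable `1 / |g|` at the point `m / x`
  have hpt (ω : Env a b W) : 2 * g ω ^ 2 - 2 * (x / m) * |g ω| - 2 * Real.log (m / x) * g ω ^ 2 ≤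
      g ω ^ 2 * Real.log (g ω ^ 2) := by
    by_cases h0 : g ω = 0
    · simp [h0]
    have hg : 0 < |g ω| := abs_pos.2 h0
    have h := Real.log_le_sub_one_of_pos (show 0 < x / m / |g ω| by positivity)
    rw [Real.log_div (by positivity) hg.ne', ← inv_div m x, Real.log_inv] at h
    rw [← sq_abs, Real.log_pow, ← inv_div m x]
    have h' := mul_le_mul_of_nonneg_left h (sq_nonneg |g ω|)
    have e : |g ω| ^ 2 * ((m / x)⁻¹ / |g ω| - 1) = (m / x)⁻¹ * |g ω| - |g ω| ^ 2 := by
      field_simp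
    rw [e] at h'
    push_cast
    linarith
  have hent : 2 * x - 2 * (x / m) * m - 2 * Real.log (m / x) * x ≤
      ∫ ω, g ω ^ 2 * Real.log (g ω ^ 2) ∂(envLaw a b p W) := by
    have := integral_mono (hint _) (hint _) hpt
    rwa [integral_sub (hint _) (hint _), integral_sub (hint _) (hint _), integral_const_mul,
      integral_const_mul, integral_const_mul] at this
  have e1 : 2 * x - 2 * (x / m) * m = 0 := by field_simp; ring
  have hlogm : 2 * Real.log m ≤ Real.log δ + Real.log y := by
    rw [← Real.log_mul hδ.ne' hypos.ne']
    have := Real.log_le_log (by positivity) h1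
    rwa [Real.log_pow] at this
  have hlogy : x * (Real.log y - Real.log x) ≤ y := by
    rw [← Real.log_div hypos.ne' hxpos.ne']
    have h := Real.log_le_sub_one_of_pos (show 0 < y / x by positivity)
    have h' := mul_le_mul_of_nonneg_left h hxpos.le
    have e : x * (y / x - 1) = y - x := by field_simp
    linarith
  rw [Real.log_div hmpos.ne' hxpos.ne'] at hent
  rw [one_div, Real.log_inv]
  have := mul_le_mul_of_nonneg_left hlogm hxpos.le
  nlinarith

/-- The Cauchy–Schwarz inequality for a function with a small support. -/
theorem sq_integral_abs_le (hp0 : 0 < p) (hp1 : p < 1) {δ : ℝ} (g : Env a b W → ℝ)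
    (h : (envLaw a b p W).real {ω | g ω ≠ 0} ≤ δ) :
    (∫ ω, |g ω| ∂(envLaw a b p W)) ^ 2 ≤ δ * ∫ ω, g ω ^ 2 ∂(envLaw a b p W) := by
  have hint := integrable_envLaw (a := a) (b := b) (W := W) hp0 hp1
  classical
  set s : Set (Env a b W) := {ω | g ω ≠ 0} with hs
  have hsm : MeasurableSet s := s.toFinite.measurableSet
  have hind : ∫ ω, s.indicator 1 ω ∂(envLaw a b p W) = (envLaw a b p W).real s :=
    integral_indicator_one hsm
  have hx0 : 0 ≤ ∫ ω, g ω ^ 2 ∂(envLaw a b p W) := integral_nonneg fun ω => sq_nonneg _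
  refine le_trans ?_ (mul_le_mul_of_nonneg_right h hx0)
  set m := ∫ ω, |g ω| ∂(envLaw a b p W) with hm
  set x := ∫ ω, g ω ^ 2 ∂(envLaw a b p W) with hx
  set π := (envLaw a b p W).real s with hπ
  -- the quadratic polynomial `t ↦ E[(t 1_s + |g|) ^ 2]` is nonnegative
  have hquad (t : ℝ) : 0 ≤ π * (t * t) + 2 * m * t + x := by
    have h0 : 0 ≤ ∫ ω, (s.indicator 1 ω * (t * t) + |g ω| * (2 * t) + g ω ^ 2)
        ∂(envLaw a b p W) := by
      refine integral_nonneg fun ω => ?_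
      by_cases hω : ω ∈ s
      · simp only [Set.indicator_of_mem hω, Pi.one_apply, Pi.zero_apply]
        nlinarith [sq_nonneg (t + |g ω|), sq_abs (g ω)]
      · have : g ω = 0 := by simpa [hs] using hω
        simp [Set.indicator_of_notMem hω, this]
    rw [integral_add (hint _) (hint _), integral_add (hint _) (hint _), integral_mul_const,
      integral_mul_const, hind] at h0
    linarith
  have := discrim_le_zero hquad
  unfold discrim at this
  nlinarith

variable [DecidableEq W]

/-- Summation of `log_mul_integral_sq_le_entropy` over the martingale differences. Averaging does
not increase norms, so the bounds `y j` on the derivatives pass to the differences. -/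
theorem log_mul_sumDiff_le (hab : a < b) (hp0 : 0 < p) (hp1 : p < 1) {δ : ℝ} (hδ : 0 < δ)
    {y : W → ℝ} (l : List W) (φ : Env a b W → ℝ)
    (h1 : ∀ j, (∫ ω, |envDeriv j φ ω| ∂(envLaw a b p W)) ^ 2 ≤ δ * y j)
    (h2 : ∀ j, ∫ ω, envDeriv j φ ω ^ 2 ∂(envLaw a b p W) ≤ y j) :
    Real.log (1 / δ) * sumDiff p (fun ψ => ∫ ω, ψ ω ^ 2 ∂(envLaw a b p W)) l φ ≤
      sumDiff p (fun ψ => ∫ ω, ψ ω ^ 2 * Real.log (ψ ω ^ 2) ∂(envLaw a b p W) -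
        (∫ ω, ψ ω ^ 2 ∂(envLaw a b p W)) * Real.log (∫ ω, ψ ω ^ 2 ∂(envLaw a b p W))) l φ +
      (l.map y).sum := by
  induction l generalizing φ with
  | nil => simp [sumDiff]
  | cons j l ih =>
    have hzero (i : W) : 0 ≤ y i := (integral_nonneg fun ω => sq_nonneg _).trans (h2 i)
    have h := ih (avg p j φ)
      (fun i => by
        by_cases hij : i = j
        · subst hij
          simpa [envDeriv_avg_same] using mul_nonneg hδ.le (hzero i)
        · rw [envDeriv_avg_of_ne hij]
          exact (pow_le_pow_left₀ (integral_nonneg fun ω => abs_nonneg _)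
            (integral_abs_avg_le hab hp0 hp1 j _) 2).trans (h1 i))
      (fun i => by
        by_cases hij : i = j
        · subst hij
          simpa [envDeriv_avg_same] using hzero i
        · rw [envDeriv_avg_of_ne hij]
          exact (integral_avg_sq_le hab hp0 hp1 j _).trans (h2 i))
    have h' := log_mul_integral_sq_le_entropy hp0 hp1 hδ (envDeriv j φ) (h1 j) (h2 j)
    simp only [sumDiff, List.map_cons, List.sum_cons]
    rw [mul_add]
    linarith

/-- Talagrand's inequality: if every derivative of `φ` vanishes outside an event of probability at
most `δ`, then the Poincaré inequality for `φ` improves by a factor `log (1 / δ)`. -/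
theorem variance_mul_log_le (hab : a < b) (hp0 : 0 < p) (hp1 : p < 1) {δ : ℝ} (hδ : 0 < δ)
    (φ : Env a b W → ℝ) (h : ∀ j, (envLaw a b p W).real {ω | envDeriv j φ ω ≠ 0} ≤ δ) :
    variance φ (envLaw a b p W) * Real.log (1 / δ) ≤
      2 * ∑ j, ∫ ω, envDeriv j φ ω ^ 2 ∂(envLaw a b p W) := by
  have hq : 0 < 1 - p := by linarith
  have hpq : 0 < p * (1 - p) := mul_pos hp0 hq
  set y : W → ℝ := fun j => ∫ ω, envDeriv j φ ω ^ 2 ∂(envLaw a b p W) with hy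
  have hy0 : 0 ≤ ∑ j, y j :=
    Finset.sum_nonneg fun j _ => integral_nonneg fun ω => sq_nonneg _
  have h1 := log_mul_sumDiff_le hab hp0 hp1 hδ (y := y) (Finset.univ : Finset W).toList φ
    (fun j => sq_integral_abs_le hp0 hp1 _ (h j)) (fun j => le_rfl)
  have h2 := sumDiff_le_sumDiff (p := p) (log_sobolev (W := W) hab hp0 hp1)
    (Finset.univ : Finset W).toList φ
  have h3 := sumDiff_energy_le hab hp0 hp1 (Finset.univ : Finset W).toList φ
  rw [Finset.sum_map_toList] at h1
  have h4 := mul_le_mul_of_nonneg_left (h1.trans (add_le_add_left h2 _)) hpq.le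
  rw [variance_eq_sumDiff hab hp0 hp1]
  have h5 : p * (1 - p) * ∑ j, y j ≤ ∑ j, y j :=
    mul_le_of_le_one_left hy0 (by nlinarith)
  linarith

end Talagrand

/-! ### The second-order inequality -/

section SecondOrder

variable {a b p : ℝ} {W : Type*} [Fintype W]

theorem l2Norm_sq (hp0 : 0 < p) (hp1 : p < 1) (g : Env a b W → ℝ) :
    l2Norm (envLaw a b p W) g ^ 2 = ∫ ω, g ω ^ 2 ∂(envLaw a b p W) := by
  have := isProbabilityMeasure_envLaw (a := a) (b := b) (W := W) hp0 hp1
  have h0 : 0 ≤ ∫ ω, g ω ^ 2 ∂(envLaw a b p W) := integral_nonneg fun ω => sq_nonneg _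
  rw [l2Norm, MemLp.eLpNorm_eq_integral_rpow_norm two_ne_zero ENNReal.ofNat_ne_top
    MemLp.of_discrete]
  simp only [ENNReal.toReal_ofNat, Real.rpow_ofNat, Real.norm_eq_abs, sq_abs]
  rw [ENNReal.toReal_ofReal (by positivity), ← Real.rpow_natCast, ← Real.rpow_mul h0]
  norm_num

/-- A function supported on an event of probability at most `1 / 2` is far from being constant. -/
theorem integral_sq_le_two_mul_variance (hp0 : 0 < p) (hp1 : p < 1) (g : Env a b W → ℝ)
    (h : (envLaw a b p W).real {ω | g ω ≠ 0} ≤ 1 / 2) :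
    ∫ ω, g ω ^ 2 ∂(envLaw a b p W) ≤ 2 * variance g (envLaw a b p W) := by
  have h1 := sq_integral_abs_le hp0 hp1 g h
  have h2 : (∫ ω, g ω ∂(envLaw a b p W)) ^ 2 ≤ (∫ ω, |g ω| ∂(envLaw a b p W)) ^ 2 :=
    sq_le_sq' (neg_le_of_abs_le (abs_integral_le_integral_abs))
      ((le_abs_self _).trans abs_integral_le_integral_abs)
  rw [variance_eq_integral_sq_sub hp0 hp1]
  linarith

variable [DecidableEq W]

/-- A double sum over edges that vanishes on the diagonal counts every pair twice. -/
theorem sum_sum_eq_two_mul_sum_powersetCard (G : W → W → ℝ) (F : Finset W → ℝ)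
    (hdiag : ∀ i, G i i = 0) (hpair : ∀ i j, i ≠ j → G i j = F {i, j}) :
    ∑ j, ∑ i, G i j = 2 * ∑ M ∈ Finset.powersetCard 2 (Finset.univ : Finset W), F M := by
  rw [Finset.sum_comm, ← Fintype.sum_prod_type', Finset.mul_sum]
  have h : ∑ x : W × W, G x.1 x.2 = ∑ x ∈ (Finset.univ : Finset W).offDiag, G x.1 x.2 := by
    refine (Finset.sum_subset (Finset.subset_univ _) fun x _ hx => ?_).symm
    have : x.1 = x.2 := by simpa [Finset.mem_offDiag] using hx
    rw [this, hdiag]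
  rw [h, ← Finset.sum_fiberwise_of_maps_to (t := Finset.powersetCard 2 (Finset.univ : Finset W))
    (g := fun x : W × W => ({x.1, x.2} : Finset W))
    (fun x hx => Finset.mem_powersetCard.2 ⟨Finset.subset_univ _,
      Finset.card_pair (Finset.mem_offDiag.1 hx).2.2⟩)]
  refine Finset.sum_congr rfl fun M hM => ?_
  obtain ⟨x, y, hxy, rfl⟩ := Finset.card_eq_two.1 (Finset.mem_powersetCard.1 hM).2
  have hfib : (Finset.univ : Finset W).offDiag.filter
      (fun z : W × W => ({z.1, z.2} : Finset W) = {x, y}) = {(x, y), (y, x)} := by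
    ext ⟨u, v⟩
    simp only [Finset.mem_filter, Finset.mem_offDiag, Finset.mem_univ, true_and,
      Finset.mem_insert, Finset.mem_singleton, Prod.mk.injEq]
    constructor
    · rintro ⟨huv, h⟩
      have hu : u ∈ ({x, y} : Finset W) := h ▸ Finset.mem_insert_self u {v}
      have hv : v ∈ ({x, y} : Finset W) := h ▸ by simp
      simp only [Finset.mem_insert, Finset.mem_singleton] at hu hv
      grind
    · rintro (⟨rfl, rfl⟩ | ⟨rfl, rfl⟩)
      · exact ⟨hxy, rfl⟩
      · exact ⟨hxy.symm, Finset.pair_comm _ _⟩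
  rw [hfib, Finset.sum_pair (by simp [hxy]), hpair x y hxy, hpair y x hxy.symm,
    Finset.pair_comm y x]
  ring

theorem sum_sum_integral_envDeriv_sq (hp0 : 0 < p) (hp1 : p < 1) (φ : Env a b W → ℝ) :
    ∑ j, ∑ i, ∫ ω, envDeriv i (envDeriv j φ) ω ^ 2 ∂(envLaw a b p W) =
      2 * ∑ M ∈ Finset.powersetCard 2 (Finset.univ : Finset W),
        l2Norm (envLaw a b p W) (setDeriv M φ) ^ 2 := by
  refine sum_sum_eq_two_mul_sum_powersetCard
    (fun i j => ∫ ω, envDeriv i (envDeriv j φ) ω ^ 2 ∂(envLaw a b p W)) _ (fun i => ?_)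
    fun i j h => ?_
  · simp [envDeriv_envDeriv_same]
  · simp only [l2Norm_sq hp0 hp1, setDeriv_pair h]

/-- The second-order version of Talagrand's inequality: apply `variance_mul_log_le` to `φ`, then
to each of its derivatives, whose second moments are comparable to their variances. -/
theorem variance_mul_log_sq_le (hab : a < b) (hp0 : 0 < p) (hp1 : p < 1) {δ : ℝ} (hδ : 0 < δ)
    (hδ2 : δ ≤ 1 / 2) (φ : Env a b W → ℝ)
    (h1 : ∀ j, (envLaw a b p W).real {ω | envDeriv j φ ω ≠ 0} ≤ δ)
    (h2 : ∀ i j, (envLaw a b p W).real {ω | envDeriv i (envDeriv j φ) ω ≠ 0} ≤ δ) :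
    variance φ (envLaw a b p W) * Real.log (1 / δ) ^ 2 ≤
      16 * ∑ M ∈ Finset.powersetCard 2 (Finset.univ : Finset W),
        l2Norm (envLaw a b p W) (setDeriv M φ) ^ 2 := by
  have hL : 0 ≤ Real.log (1 / δ) :=
    Real.log_nonneg (by rw [le_div_iff₀ hδ]; linarith)
  have e := sum_sum_integral_envDeriv_sq hp0 hp1 φ
  have hφ := mul_le_mul_of_nonneg_right (variance_mul_log_le hab hp0 hp1 hδ φ h1) hL
  have hj (j : W) : (∫ ω, envDeriv j φ ω ^ 2 ∂(envLaw a b p W)) * Real.log (1 / δ) ≤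
      4 * ∑ i, ∫ ω, envDeriv i (envDeriv j φ) ω ^ 2 ∂(envLaw a b p W) := by
    have k1 := mul_le_mul_of_nonneg_right
      (integral_sq_le_two_mul_variance hp0 hp1 (envDeriv j φ) ((h1 j).trans hδ2)) hL
    have k2 := variance_mul_log_le hab hp0 hp1 hδ (envDeriv j φ) fun i => h2 i j
    linarith
  have hsum := Finset.sum_le_sum fun j (_ : j ∈ (Finset.univ : Finset W)) => hj j
  rw [← Finset.sum_mul, ← Finset.mul_sum, e] at hsum
  calc variance φ (envLaw a b p W) * Real.log (1 / δ) ^ 2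
      = variance φ (envLaw a b p W) * Real.log (1 / δ) * Real.log (1 / δ) := by ring
    _ ≤ _ := by linarith

theorem numConvoluted_eq_card (φ : Env a b W → ℝ) (ω : Env a b W) :
    numConvoluted φ ω = ((Finset.powersetCard 2 (Finset.univ : Finset W)).filter
      fun M => setDeriv M φ ω ≠ 0).card := by
  rw [numConvoluted, ← Set.ncard_coe_finset]
  congr 1
  ext M
  simp only [Set.mem_ofPred_eq, Finset.coe_filter, Finset.mem_powersetCard, Finset.subset_univ,
    true_and]
  constructor
  · rintro ⟨i, j, hij, rfl, h⟩
    exact ⟨Finset.card_pair hij, by rwa [setDeriv_pair hij]⟩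
  · rintro ⟨hM, h⟩
    obtain ⟨i, j, hij, rfl⟩ := Finset.card_eq_two.1 hM
    exact ⟨i, j, hij, rfl, by rwa [setDeriv_pair hij] at h⟩

theorem sum_l2Norm_sq_le (hp0 : 0 < p) (hp1 : p < 1) (φ : Env a b W → ℝ) {c : ℝ}
    (hφ : ∀ i j ω, |envDeriv i (envDeriv j φ) ω| ≤ c) :
    ∑ M ∈ Finset.powersetCard 2 (Finset.univ : Finset W),
        l2Norm (envLaw a b p W) (setDeriv M φ) ^ 2 ≤
      c ^ 2 * ∫ ω, (numConvoluted φ ω : ℝ) ∂(envLaw a b p W) := by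
  have hint := integrable_envLaw (a := a) (b := b) (W := W) hp0 hp1
  simp only [l2Norm_sq hp0 hp1]
  rw [← integral_finsetSum _ fun M _ => hint _, ← integral_const_mul]
  refine integral_mono (hint _) (hint _) fun ω => ?_
  simp only [numConvoluted_eq_card, Finset.card_filter]
  push_cast
  rw [Finset.mul_sum]
  refine Finset.sum_le_sum fun M hM => ?_
  obtain ⟨i, j, hij, rfl⟩ := Finset.card_eq_two.1 (Finset.mem_powersetCard.1 hM).2
  rw [setDeriv_pair hij]
  split_ifs with h
  · rw [mul_one]
    exact sq_le_sq.2 ((hφ i j ω).trans (le_abs_self c))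
  · simp [not_not.1 h]

/-- The derivative of `ψ` can only be nonzero if `ψ` is nonzero for one of the two values of the
passage time of the edge. -/
theorem prob_envDeriv_ne_zero_le (hab : a < b) (hp0 : 0 < p) (hp1 : p < 1) (i : W)
    (ψ : Env a b W → ℝ) :
    (envLaw a b p W).real {ω | envDeriv i ψ ω ≠ 0} ≤
      (1 / p + 1 / (1 - p)) * (envLaw a b p W).real {ω | ψ ω ≠ 0} := by
  have hint := integrable_envLaw (a := a) (b := b) (W := W) hp0 hp1
  have hq : 0 < 1 - p := by linarith
  have hind (s : Set (Env a b W)) :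
      (envLaw a b p W).real s = ∫ ω, s.indicator 1 ω ∂(envLaw a b p W) :=
    (integral_indicator_one s.toFinite.measurableSet).symm
  have h01 (s : Set (Env a b W)) (ω : Env a b W) : 0 ≤ s.indicator (1 : Env a b W → ℝ) ω :=
    Set.indicator_nonneg (fun _ _ => zero_le_one) ω
  rw [hind, hind, ← integral_avg hab hp0 hp1 i (Set.indicator {ω | ψ ω ≠ 0} 1),
    ← integral_const_mul]
  refine integral_mono (hint _) (hint _) fun ω => ?_
  set x := Set.indicator {ω | ψ ω ≠ 0} (1 : Env a b W → ℝ) (setEdge i (timeA a b) ω) with hx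
  set y := Set.indicator {ω | ψ ω ≠ 0} (1 : Env a b W → ℝ) (setEdge i (timeB a b) ω) with hy
  have hx0 : 0 ≤ x := h01 _ _
  have hy0 : 0 ≤ y := h01 _ _
  have hle : Set.indicator {ω | envDeriv i ψ ω ≠ 0} (1 : Env a b W → ℝ) ω ≤ x + y := by
    by_cases hω : envDeriv i ψ ω = 0
    · rw [Set.indicator_of_notMem (by simpa using hω)]
      positivity
    · rw [Set.indicator_of_mem (by simpa using hω), Pi.one_apply]
      by_cases hA : ψ (setEdge i (timeA a b) ω) = 0
      · have hB : ψ (setEdge i (timeB a b) ω) ≠ 0 := fun hB => hω (by simp [envDeriv, hA, hB])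
        have : y = 1 := Set.indicator_of_mem hB _
        linarith
      · have : x = 1 := Set.indicator_of_mem hA _
        linarith
  refine hle.trans ?_
  have e : (1 / p + 1 / (1 - p)) * avg p i (Set.indicator {ω | ψ ω ≠ 0} 1) ω =
      x + y + ((1 - p) / p * y + p / (1 - p) * x) := by
    simp only [avg, ← hx, ← hy]
    field_simp
    ring
  rw [e, le_add_iff_nonneg_right]
  positivity

/-- The derivative `∂_j φ` does not depend on the passage time of `j`, so conditioning this passage
time to be `a` does not change the probability that `∂_j φ` is nonzero. -/
theorem prob_envDeriv_ne_zero_and_timeA (hab : a < b) (hp0 : 0 < p) (hp1 : p < 1) (j : W)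
    (φ : Env a b W → ℝ) :
    (envLaw a b p W).real {ω | envDeriv j φ ω ≠ 0 ∧ ω j = timeA a b} =
      p * (envLaw a b p W).real {ω | envDeriv j φ ω ≠ 0} := by
  classical
  have hind (s : Set (Env a b W)) :
      (envLaw a b p W).real s = ∫ ω, s.indicator 1 ω ∂(envLaw a b p W) :=
    (integral_indicator_one s.toFinite.measurableSet).symm
  rw [hind, hind, ← integral_avg hab hp0 hp1 j, ← integral_const_mul]
  congr 1
  funext ω
  have hB : setEdge j (timeB a b) ω j = timeB a b := Function.update_self _ _ _
  have hA : setEdge j (timeA a b) ω j = timeA a b := Function.update_self _ _ _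
  simp [avg, Set.indicator_apply, envDeriv_setEdge_same, hA, hB, (timeA_ne_timeB hab).symm]

end SecondOrder

/-! ### Admissible paths -/

section Paths

variable {a b : ℝ} {d n : ℕ} [NeZero d]

/-- The straight path ending at the origin. It starts at `-m`, so that prepending a vertex to it adds
`1` to the displacement. -/
theorem exists_straight_path (hn : 3 ≤ n) (m : ℕ) (hm : m < n) :
    ∃ w : (torus d n).Walk (Pi.single 0 (-(m : ZMod n))) (Pi.single 0 (-((0 : ℕ) : ZMod n))),
      w.IsPath ∧ (∀ z ∈ w.support, ∃ k ≤ m, z = Pi.single 0 (-(k : ZMod n))) ∧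
      (∀ e ∈ w.edges, ∃ k < m, e =
        s(Pi.single 0 (-((k + 1 : ℕ) : ZMod n)), Pi.single 0 (-(k : ZMod n)))) ∧
      liftedDisplacement w = m ∧ w.length = m := by
  have : Fact (1 < n) := ⟨by omega⟩
  induction m with
  | zero => exact ⟨.nil, by simp [liftedDisplacement]⟩
  | succ m ih =>
    obtain ⟨w, h1, h2, h3, h4, h5⟩ := ih (by omega)
    have hne : ∀ k ≤ m, (Pi.single 0 (-((m + 1 : ℕ) : ZMod n)) : Fin d → ZMod n) ≠
        Pi.single 0 (-(k : ZMod n)) := by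
      intro k hk h
      have h' := neg_injective (Pi.single_injective 0 h)
      rw [ZMod.natCast_eq_natCast_iff', Nat.mod_eq_of_lt hm, Nat.mod_eq_of_lt (by omega)] at h'
      omega
    have hadj : (torus d n).Adj (Pi.single 0 (-((m + 1 : ℕ) : ZMod n)))
        (Pi.single 0 (-(m : ZMod n))) := by
      refine ⟨hne m le_rfl, 0, Or.inr ?_, fun l hl => ?_⟩
      · simp
      · simp [hl]
    refine ⟨.cons hadj w, ?_, ?_, ?_, ?_, ?_⟩
    · refine h1.cons fun hmem => ?_
      obtain ⟨k, hk, h⟩ := h2 _ hmem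
      exact hne k hk h
    · intro z hz
      rw [SimpleGraph.Walk.support_cons, List.mem_cons] at hz
      rcases hz with rfl | hz
      · exact ⟨m + 1, le_rfl, rfl⟩
      · obtain ⟨k, hk, h⟩ := h2 z hz
        exact ⟨k, by omega, h⟩
    · intro e he
      rw [SimpleGraph.Walk.edges_cons, List.mem_cons] at he
      rcases he with rfl | he
      · exact ⟨m, by omega, rfl⟩
      · obtain ⟨k, hk, h⟩ := h3 e he
        exact ⟨k, by omega, h⟩
    · have h1' : (1 : ZMod n).valMinAbs = 1 := by
        have := ZMod.valMinAbs_natCast_of_le_half (n := n) (a := 1) (by omega)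
        simpa using this
      simp only [liftedDisplacement, SimpleGraph.Walk.darts_cons, List.map_cons,
        List.sum_cons] at h4 ⊢
      rw [h4]
      simp [h1']
      ring
    · simp [h5]

/-- The straight loop in the direction of the first coordinate. -/
theorem exists_isAdmissible_card_le (hn : 3 ≤ n) :
    ∃ γ : Finset (Edge d n), IsAdmissible γ ∧ γ.card ≤ n := by
  classical
  have : NeZero n := ⟨by omega⟩
  obtain ⟨w, h1, -, h3, h4, h5⟩ := exists_straight_path (d := d) hn (n - 1) (by omega)
  have hcast : ((n - 1 : ℕ) : ZMod n) = -1 := by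
    rw [Nat.cast_sub (by omega)]
    simp
  have h1' : (1 : ZMod n).valMinAbs = 1 := by
    have := ZMod.valMinAbs_natCast_of_le_half (n := n) (a := 1) (by omega)
    simpa using this
  have : Fact (1 < n) := ⟨by omega⟩
  have hadj : (torus d n).Adj (Pi.single 0 (-((0 : ℕ) : ZMod n)))
      (Pi.single 0 (-((n - 1 : ℕ) : ZMod n))) := by
    refine ⟨fun h => ?_, 0, Or.inr ?_, fun l hl => ?_⟩
    · have h' := Pi.single_injective 0 h
      rw [hcast] at h'
      simp at h'
    · rw [hcast]
      simp
    · simp [hl]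
  have hcycle : (SimpleGraph.Walk.cons hadj w).IsCycle := by
    rw [SimpleGraph.Walk.cons_isCycle_iff]
    refine ⟨h1, fun hmem => ?_⟩
    obtain ⟨k, hk, h⟩ := h3 _ hmem
    have hinj {i j : ℕ} (hi : i < n) (hj : j < n) (h : (Pi.single 0 (-(i : ZMod n)) :
        Fin d → ZMod n) = Pi.single 0 (-(j : ZMod n))) : i = j := by
      have h' := neg_injective (Pi.single_injective 0 h)
      rwa [ZMod.natCast_eq_natCast_iff', Nat.mod_eq_of_lt hi, Nat.mod_eq_of_lt hj] at h'
    rw [Sym2.eq_iff] at h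
    rcases h with ⟨e, -⟩ | ⟨e, f⟩
    · have := hinj (by omega) (by omega) e
      omega
    · have := hinj (by omega) (by omega) e
      have := hinj (by omega) (by omega) f
      omega
  refine ⟨Finset.univ.filter fun e => (e : Sym2 _) ∈ (SimpleGraph.Walk.cons hadj w).edges,
    ⟨_, _, hcycle, ?_, fun e => by simp only [Finset.mem_filter, Finset.mem_univ, true_and]⟩, ?_⟩
  · simp only [liftedDisplacement, SimpleGraph.Walk.darts_cons, List.map_cons,
      List.sum_cons] at h4 ⊢
    rw [h4, hcast, Nat.cast_sub (by omega)]
    simp [h1']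
  · rw [← Finset.card_map (Function.Embedding.subtype _)]
    refine (Finset.card_le_card (t := (SimpleGraph.Walk.cons hadj w).edges.toFinset) ?_).trans
      ((List.toFinset_card_le _).trans ?_)
    · intro e he
      obtain ⟨e', he', rfl⟩ := Finset.mem_map.1 he
      exact List.mem_toFinset.2 (Finset.mem_filter.1 he').2
    · rw [SimpleGraph.Walk.length_edges, SimpleGraph.Walk.length_cons, h5]
      omega

theorem finite_passageTimes [NeZero n] (ω : Env a b (Edge d n)) :
    {t : ℝ | ∃ γ : Finset (Edge d n), IsAdmissible γ ∧ t = passageTime γ ω}.Finite :=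
  (Set.finite_range fun γ : Finset (Edge d n) => passageTime γ ω).subset (by
    rintro t ⟨γ, -, rfl⟩
    exact ⟨γ, rfl⟩)

theorem fpt_le [NeZero n] {γ : Finset (Edge d n)} (hγ : IsAdmissible γ) (ω : Env a b (Edge d n)) :
    fpt a b d n ω ≤ passageTime γ ω :=
  csInf_le (finite_passageTimes ω).bddBelow ⟨γ, hγ, rfl⟩

theorem exists_fpt_eq (hn : 3 ≤ n) (ω : Env a b (Edge d n)) :
    ∃ γ : Finset (Edge d n), IsAdmissible γ ∧ fpt a b d n ω = passageTime γ ω := by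
  have : NeZero n := ⟨by omega⟩
  obtain ⟨γ, hγ, -⟩ := exists_isAdmissible_card_le (d := d) hn
  exact Set.Nonempty.csInf_mem (s := {t : ℝ | ∃ γ, IsAdmissible γ ∧ t = passageTime γ ω})
    ⟨_, γ, hγ, rfl⟩ (finite_passageTimes ω)

end Paths

/-! ### The derivatives of the first-passage time -/

section Derivatives

variable {a b : ℝ} {d n : ℕ} [NeZero d]

theorem le_of_mem_pair (hab : a < b) (x : ({a, b} : Set ℝ)) : a ≤ x ∧ (x : ℝ) ≤ b := by
  obtain ⟨x, rfl | rfl⟩ := x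
  · exact ⟨le_rfl, hab.le⟩
  · exact ⟨hab.le, le_rfl⟩

theorem passageTime_setEdge {W : Type*} [DecidableEq W] (γ : Finset W) (j : W)
    (δ : ({a, b} : Set ℝ)) (ω : Env a b W) :
    passageTime γ (setEdge j δ ω) = passageTime γ ω + if j ∈ γ then (δ : ℝ) - ω j else 0 := by
  have h (e : W) : ((setEdge j δ ω e : ({a, b} : Set ℝ)) : ℝ) =
      ω e + if e = j then (δ : ℝ) - ω j else 0 := by
    by_cases he : e = j
    · subst he; simp [setEdge]
    · simp [setEdge, he]
  simp only [passageTime, h, Finset.sum_add_distrib, Finset.sum_ite_eq']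

theorem fpt_setEdge_mono (hn : 3 ≤ n) (j : Edge d n) {δ ε : ({a, b} : Set ℝ)}
    (h : (δ : ℝ) ≤ ε) (ω : Env a b (Edge d n)) :
    fpt a b d n (setEdge j δ ω) ≤ fpt a b d n (setEdge j ε ω) := by
  have : NeZero n := ⟨by omega⟩
  obtain ⟨γ, hγ, e⟩ := exists_fpt_eq hn (setEdge j ε ω)
  rw [e]
  refine (fpt_le hγ _).trans ?_
  rw [passageTime_setEdge, passageTime_setEdge]
  split_ifs <;> linarith

theorem fpt_setEdge_le_add (hn : 3 ≤ n) (j : Edge d n) {δ ε : ({a, b} : Set ℝ)}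
    (h : (δ : ℝ) ≤ ε) (ω : Env a b (Edge d n)) :
    fpt a b d n (setEdge j ε ω) ≤ fpt a b d n (setEdge j δ ω) + (ε - δ) := by
  have : NeZero n := ⟨by omega⟩
  obtain ⟨γ, hγ, e⟩ := exists_fpt_eq hn (setEdge j δ ω)
  rw [e]
  refine (fpt_le hγ _).trans ?_
  rw [passageTime_setEdge, passageTime_setEdge]
  split_ifs <;> linarith

theorem envDeriv_fpt_nonneg (hab : a < b) (hn : 3 ≤ n) (j : Edge d n) (ω : Env a b (Edge d n)) :
    0 ≤ envDeriv j (fpt a b d n) ω :=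
  sub_nonneg.2 (fpt_setEdge_mono hn j hab.le ω)

theorem envDeriv_fpt_le (hab : a < b) (hn : 3 ≤ n) (j : Edge d n) (ω : Env a b (Edge d n)) :
    envDeriv j (fpt a b d n) ω ≤ b - a :=
  sub_le_iff_le_add'.2 (fpt_setEdge_le_add hn j (δ := timeA a b) (ε := timeB a b) hab.le ω)

theorem abs_envDeriv_envDeriv_fpt_le (hab : a < b) (hn : 3 ≤ n) (i j : Edge d n)
    (ω : Env a b (Edge d n)) : |envDeriv i (envDeriv j (fpt a b d n)) ω| ≤ b - a :=
  (abs_sub_le_of_nonneg_of_le (envDeriv_fpt_nonneg hab hn j _) (envDeriv_fpt_le hab hn j _)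
    (envDeriv_fpt_nonneg hab hn j _) (envDeriv_fpt_le hab hn j _))

/-- An edge with passage time `a` whose derivative does not vanish lies on every geodesic, and a
geodesic has at most `n b / a` edges, as the straight loop has passage time at most `n b`. -/
theorem card_envDeriv_ne_zero_le (ha : 0 < a) (hab : a < b) [NeZero n] (hn : 3 ≤ n)
    (ω : Env a b (Edge d n)) (S : Finset (Edge d n))
    (hS : ∀ j ∈ S, envDeriv j (fpt a b d n) ω ≠ 0 ∧ ω j = timeA a b) :
    (S.card : ℝ) ≤ n * b / a := by
  obtain ⟨γ, hγ, e⟩ := exists_fpt_eq hn ω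
  have hsub : S ⊆ γ := by
    intro j hj
    obtain ⟨hne, hj⟩ := hS j hj
    by_contra hjγ
    have hA : setEdge j (timeA a b) ω = ω := by rw [← hj]; exact Function.update_eq_self _ _
    have hle : fpt a b d n (setEdge j (timeB a b) ω) ≤ fpt a b d n ω := by
      refine (fpt_le hγ _).trans ?_
      rw [passageTime_setEdge, if_neg hjγ, add_zero, e]
    have h0 := envDeriv_fpt_nonneg hab hn j ω
    refine hne (le_antisymm ?_ h0)
    rw [envDeriv, hA]
    linarith
  obtain ⟨γ', hγ', hcard⟩ := exists_isAdmissible_card_le (d := d) hn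
  have h1 : (γ.card : ℝ) * a ≤ passageTime γ ω := by
    rw [← nsmul_eq_mul]
    exact Finset.card_nsmul_le_sum _ _ _ fun e _ => (le_of_mem_pair hab (ω e)).1
  have h2 : passageTime γ' ω ≤ γ'.card * b := by
    rw [← nsmul_eq_mul]
    exact Finset.sum_le_card_nsmul _ _ _ fun e _ => (le_of_mem_pair hab (ω e)).2
  have h3 := fpt_le hγ' ω
  have h4 : (γ'.card : ℝ) ≤ n := by exact_mod_cast hcard
  have h5 : (S.card : ℝ) ≤ γ.card := by exact_mod_cast Finset.card_le_card hsub
  rw [le_div_iff₀ ha]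
  have h6 := mul_le_mul_of_nonneg_right h4 (ha.trans hab).le
  have h7 := mul_le_mul_of_nonneg_right h5 ha.le
  linarith

end Derivatives

/-! ### Translations of the torus -/

section Translations

variable {a b p : ℝ} {d n : ℕ}

/-- The translation of the torus by the vector `t`. -/
noncomputable def translate (t : Fin d → ZMod n) : torus d n ≃g torus d n where
  toEquiv := Equiv.addRight t
  map_rel_iff' := by simp [torus]

theorem card_translate_mem_le [NeZero n] (j : Edge d n) (S : Finset (Edge d n))
    [DecidablePred fun t => (translate t).mapEdgeSet j ∈ S] :
    ((Finset.univ : Finset (Fin d → ZMod n)).filter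
      fun t => (translate t).mapEdgeSet j ∈ S).card ≤ 2 * S.card := by
  classical
  refine Finset.card_le_mul_card_image_of_maps_to (f := fun t => (translate t).mapEdgeSet j)
    (fun t ht => (Finset.mem_filter.1 ht).2) 2 fun e _ => ?_
  obtain ⟨j, hj⟩ := j
  obtain ⟨e, he⟩ := e
  induction j with | _ u v =>
  induction e with | _ x y =>
  refine (Finset.card_le_card (t := {x - u, y - u}) fun t ht => ?_).trans Finset.card_le_two
  have h : s(u + t, v + t) = s(x, y) := congrArg Subtype.val (Finset.mem_filter.1 ht).2
  rw [Finset.mem_insert, Finset.mem_singleton]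
  rcases Sym2.eq_iff.1 h with ⟨h, -⟩ | ⟨h, -⟩
  · left; rw [← h]; abel
  · right; rw [← h]; abel

variable [NeZero d]

theorem IsAdmissible.map_translate {γ : Finset (Edge d n)} (hγ : IsAdmissible γ)
    (t : Fin d → ZMod n) :
    IsAdmissible (γ.map (translate t).mapEdgeSet.toEmbedding) := by
  obtain ⟨v, c, hc, hdisp, hmem⟩ := hγ
  refine ⟨translate t v, c.map (translate t).toHom, ?_, ?_, fun e => ?_⟩
  · exact hc.map (translate t).injective
  · rw [← hdisp, liftedDisplacement, liftedDisplacement, SimpleGraph.Walk.darts_map, List.map_map]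
    congr 2
    funext e
    simp [translate]
  · rw [SimpleGraph.Walk.edges_map, List.mem_map]
    constructor
    · intro he
      obtain ⟨e', he', rfl⟩ := Finset.mem_map.1 he
      exact ⟨e', (hmem e').1 he', rfl⟩
    · rintro ⟨e', he', heq⟩
      have hE : e' ∈ (torus d n).edgeSet := c.edges_subset_edgeSet he'
      exact Finset.mem_map.2 ⟨⟨e', hE⟩, (hmem ⟨e', hE⟩).2 he', Subtype.ext heq⟩

theorem fpt_le_fpt_comp_translate (hn : 3 ≤ n) (t : Fin d → ZMod n) (ω : Env a b (Edge d n)) :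
    fpt a b d n ω ≤ fpt a b d n (ω ∘ (translate t).mapEdgeSet) := by
  have : NeZero n := ⟨by omega⟩
  obtain ⟨γ, hγ, e⟩ := exists_fpt_eq hn (ω ∘ (translate t).mapEdgeSet)
  rw [e]
  refine (fpt_le (hγ.map_translate t) ω).trans_eq ?_
  simp [passageTime]

theorem fpt_comp_translate (hn : 3 ≤ n) (t : Fin d → ZMod n) (ω : Env a b (Edge d n)) :
    fpt a b d n (ω ∘ (translate t).mapEdgeSet) = fpt a b d n ω := by
  refine le_antisymm ?_ (fpt_le_fpt_comp_translate hn t ω)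
  refine (fpt_le_fpt_comp_translate hn (-t) _).trans_eq ?_
  congr 1
  funext e
  obtain ⟨e, he⟩ := e
  refine congrArg ω (Subtype.ext ?_)
  change Sym2.map (translate t) (Sym2.map (translate (-t)) e) = e
  rw [Sym2.map_map]
  have h : translate t ∘ translate (-t) = id := by
    funext x
    exact neg_add_cancel_right x t
  rw [h, Sym2.map_id, id]

theorem envDeriv_fpt_translate (hn : 3 ≤ n) (t : Fin d → ZMod n) (j : Edge d n)
    (ω : Env a b (Edge d n)) :
    envDeriv ((translate t).mapEdgeSet j) (fpt a b d n) ω =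
      envDeriv j (fpt a b d n) (ω ∘ (translate t).mapEdgeSet) := by
  have h (δ : ({a, b} : Set ℝ)) : setEdge j δ (ω ∘ (translate t).mapEdgeSet) =
      setEdge ((translate t).mapEdgeSet j) δ ω ∘ (translate t).mapEdgeSet :=
    (Function.update_comp_eq_of_injective ω (translate t).mapEdgeSet.injective j δ).symm
  simp only [envDeriv, h, fpt_comp_translate hn]

theorem prob_envDeriv_fpt_translate [NeZero n] (hn : 3 ≤ n) (hp0 : 0 < p) (hp1 : p < 1)
    (t : Fin d → ZMod n) (j : Edge d n) :
    (envLaw a b p (Edge d n)).real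
        {ω | envDeriv ((translate t).mapEdgeSet j) (fpt a b d n) ω ≠ 0} =
      (envLaw a b p (Edge d n)).real {ω | envDeriv j (fpt a b d n) ω ≠ 0} := by
  have := isProbabilityMeasure_edgeLaw (a := a) (b := b) hp0 hp1
  have hmp := (measurePreserving_piCongrLeft (fun _ : Edge d n => edgeLaw a b p)
    (translate t).mapEdgeSet).symm
  simp only [envDeriv_fpt_translate hn]
  exact hmp.measureReal_preimage (s := {ω | envDeriv j (fpt a b d n) ω ≠ 0})
    (Set.toFinite _).measurableSet.nullMeasurableSet

/-- All the translates of an edge have the same influence, and on average only few of them lie on a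
geodesic. -/
theorem prob_envDeriv_fpt_ne_zero_le (ha : 0 < a) (hab : a < b) (hp0 : 0 < p) (hp1 : p < 1)
    (hd : 2 ≤ d) [NeZero n] (hn : 3 ≤ n) (j : Edge d n) :
    (envLaw a b p (Edge d n)).real {ω | envDeriv j (fpt a b d n) ω ≠ 0} ≤
      2 * b / (a * p) / n := by
  classical
  have hprob := isProbabilityMeasure_envLaw (a := a) (b := b) (W := Edge d n) hp0 hp1
  have hint := integrable_envLaw (a := a) (b := b) (W := Edge d n) hp0 hp1
  set P := (envLaw a b p (Edge d n)).real {ω | envDeriv j (fpt a b d n) ω ≠ 0} with hP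
  have hP0 : 0 ≤ P := measureReal_nonneg
  have hn0 : (0 : ℝ) < n := by positivity
  have hsum : ∑ t : Fin d → ZMod n, p * P ≤ 2 * (n * b / a) := by
    calc ∑ t : Fin d → ZMod n, p * P
        = ∑ t : Fin d → ZMod n, ∫ ω, Set.indicator
            {ω | envDeriv ((translate t).mapEdgeSet j) (fpt a b d n) ω ≠ 0 ∧
              ω ((translate t).mapEdgeSet j) = timeA a b} 1 ω ∂(envLaw a b p (Edge d n)) := by
          refine Finset.sum_congr rfl fun t _ => ?_
          rw [integral_indicator_one (Set.toFinite _).measurableSet,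
            prob_envDeriv_ne_zero_and_timeA hab hp0 hp1, prob_envDeriv_fpt_translate hn hp0 hp1]
      _ = ∫ ω, ∑ t : Fin d → ZMod n, Set.indicator
            {ω | envDeriv ((translate t).mapEdgeSet j) (fpt a b d n) ω ≠ 0 ∧
              ω ((translate t).mapEdgeSet j) = timeA a b} 1 ω ∂(envLaw a b p (Edge d n)) :=
          (integral_finsetSum _ fun t _ => hint _).symm
      _ ≤ ∫ ω, 2 * (n * b / a) ∂(envLaw a b p (Edge d n)) := by
          refine integral_mono (hint _) (hint _) fun ω => ?_
          set S := (Finset.univ : Finset (Edge d n)).filter fun i =>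
            envDeriv i (fpt a b d n) ω ≠ 0 ∧ ω i = timeA a b with hS
          have h1 : (S.card : ℝ) ≤ n * b / a :=
            card_envDeriv_ne_zero_le ha hab hn ω S fun i hi => (Finset.mem_filter.1 hi).2
          have h2 : (((Finset.univ : Finset (Fin d → ZMod n)).filter
              fun t => (translate t).mapEdgeSet j ∈ S).card : ℝ) ≤ 2 * S.card := by
            exact_mod_cast card_translate_mem_le j S
          refine le_trans (le_of_eq ?_) (h2.trans (by linarith))
          rw [Finset.card_filter]
          push_cast
          refine Finset.sum_congr rfl fun t _ => ?_
          simp only [Set.indicator_apply, hS, Finset.mem_filter, Finset.mem_univ, true_and,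
            Set.mem_ofPred_eq, Pi.one_apply]
      _ = 2 * (n * b / a) := by simp
  rw [Finset.sum_const, nsmul_eq_mul, Finset.card_univ, Fintype.card_fun, ZMod.card,
    Fintype.card_fin, Nat.cast_pow] at hsum
  have hn1 : (1 : ℝ) ≤ n := by exact_mod_cast NeZero.one_le
  have hpow : (n : ℝ) ^ 2 ≤ (n : ℝ) ^ d := pow_le_pow_right₀ hn1 hd
  have h3 := (mul_le_mul_of_nonneg_right hpow (mul_nonneg hp0.le hP0)).trans hsum
  have h4 : n * (a * p * P * n) ≤ n * (2 * b) := by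
    have := mul_le_mul_of_nonneg_left h3 ha.le
    calc n * (a * p * P * n) = a * (n ^ 2 * (p * P)) := by ring
      _ ≤ a * (2 * (n * b / a)) := this
      _ = n * (2 * b) := by field_simp
  rw [le_div_iff₀ hn0, le_div_iff₀ (by positivity)]
  have h5 := le_of_mul_le_mul_left h4 hn0
  linarith

end Translations

end TorusFPP

theorem corollary3 (d : ℕ) [NeZero d] (hd : 2 ≤ d) (a b p : ℝ) (ha : 0 < a) (hab : a < b)
    (hp0 : 0 < p) (hp1 : p < 1) :
    ∃ C C' : ℝ, 0 < C ∧ 0 < C' ∧ ∃ n₀ : ℕ, ∀ (n : ℕ) [NeZero n], n₀ ≤ n →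
      variance (TorusFPP.fpt a b d n) (TorusFPP.envLaw a b p (TorusFPP.Edge d n)) ≤
        C * ((∑ M ∈ Finset.powersetCard 2 (Finset.univ : Finset (TorusFPP.Edge d n)),
          TorusFPP.l2Norm (TorusFPP.envLaw a b p (TorusFPP.Edge d n))
            (TorusFPP.setDeriv M (TorusFPP.fpt a b d n)) ^ 2) / Real.log n ^ 2) ∧
      C * ((∑ M ∈ Finset.powersetCard 2 (Finset.univ : Finset (TorusFPP.Edge d n)),
          TorusFPP.l2Norm (TorusFPP.envLaw a b p (TorusFPP.Edge d n))
            (TorusFPP.setDeriv M (TorusFPP.fpt a b d n)) ^ 2) / Real.log n ^ 2) ≤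
        C' * ((∫ ω, (TorusFPP.numConvoluted (TorusFPP.fpt a b d n) ω : ℝ)
          ∂(TorusFPP.envLaw a b p (TorusFPP.Edge d n))) / Real.log n ^ 2) := by
  have hb : 0 < b := ha.trans hab
  have hq : 0 < 1 - p := by linarith
  have hba : 0 < b - a := by linarith
  set R := 1 / p + 1 / (1 - p) with hR
  set K := R * (2 * b / (a * p)) with hK
  have hR1 : 1 ≤ R := by
    have h1 : 1 ≤ 1 / p := by rw [le_div_iff₀ hp0]; linarith
    have h2 : 0 < 1 / (1 - p) := by positivity
    linarith
  have hK0 : 0 ≤ K := by positivity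
  refine ⟨64, 64 * (b - a) ^ 2, by norm_num, by positivity, max 4 ⌈K ^ 2⌉₊, fun n _ hn => ?_⟩
  have hn4 : 4 ≤ n := (le_max_left _ _).trans hn
  have hn3 : 3 ≤ n := by omega
  have hn4' : (4 : ℝ) ≤ n := by exact_mod_cast hn4
  have hnK : K ^ 2 ≤ n := (Nat.le_ceil _).trans (by exact_mod_cast (le_max_right _ _).trans hn)
  have hn0 : (0 : ℝ) < n := by linarith
  have hsqrt : 2 ≤ √(n : ℝ) := Real.le_sqrt_of_sq_le (by linarith)
  have hsqrt0 : 0 < √(n : ℝ) := by linarith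
  have hlog : 0 < Real.log n := Real.log_pos (by linarith)
  -- influences are of order `1 / n`, hence eventually below `δ = 1 / √n`, and `log (1 / δ)` is
  -- half of `log n`
  have hKn : K / n ≤ 1 / √(n : ℝ) := by
    rw [div_le_div_iff₀ hn0 hsqrt0, one_mul]
    calc K * √(n : ℝ) ≤ √(n : ℝ) * √(n : ℝ) := by gcongr; exact Real.le_sqrt_of_sq_le hnK
      _ = n := Real.mul_self_sqrt hn0.le
  have hinf (j : TorusFPP.Edge d n) := TorusFPP.prob_envDeriv_fpt_ne_zero_le ha hab hp0 hp1 hd hn3 j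
  have hvar := TorusFPP.variance_mul_log_sq_le (p := p) hab hp0 hp1 (δ := 1 / √(n : ℝ))
    (by positivity) (one_div_le_one_div_of_le two_pos hsqrt) (TorusFPP.fpt a b d n)
    (fun j => (hinf j).trans <| le_trans
      (by gcongr; exact le_mul_of_one_le_left (by positivity) hR1) hKn)
    (fun i j => (TorusFPP.prob_envDeriv_ne_zero_le hab hp0 hp1 i _).trans <|
      (mul_le_mul_of_nonneg_left (hinf j) (by positivity)).trans <| by
        rw [← mul_div_assoc]; exact hKn)
  have hlogδ : Real.log (1 / (1 / √(n : ℝ))) = Real.log n / 2 := by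
    rw [one_div_one_div, Real.log_sqrt hn0.le]
  rw [hlogδ] at hvar
  constructor
  · rw [← mul_div_assoc, le_div_iff₀ (by positivity)]
    linarith
  · have hN := TorusFPP.sum_l2Norm_sq_le (p := p) hp0 hp1 (TorusFPP.fpt a b d n)
      (TorusFPP.abs_envDeriv_envDeriv_fpt_le hab hn3)
    rw [mul_assoc, ← mul_div_assoc ((b - a) ^ 2)]
    gcongr
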